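/- For a group $G$ let $L^2(G)$ be the Hilbert space of square summable formal sums $\sum_{g\in G}\lambda_g\, g$ with $\lambda_g\in\mathbb{C}$. A matrix $A=(a_{k,j})\in M_{r,s}(\mathbb{Z}G)$ defines by right multiplication a bounded $G$-equivariant operator $$r_A^{(2)}\colon L^2(G)^r\to L^2(G)^s,\qquad (x_k)_{k}\mapsto\Bigl(\sum_{k=1}^r x_k a_{k,j}\Bigr)_{j}.$$ For a bounded $G$-equivariant operator $f\colon L^2(G)^r\to L^2(G)^s$ let $E_\mu=\mathbf 1_{(-\infty,\mu]}(f^*f)$ be the spectral projections of $f^*f$, and let $F_f(\lambda)=\dim_{\mathcal{N}(G)}(\operatorname{im}E_{\lambda^2})$ for $\lambda\ge 0$ and $F_f(\lambda)=0$ for $\lambda<0$, where the von Neumann dimension of the image of a $G$-equivariant orthogonal projection $P$ of $L^2(G)^r$ is $\sum_{i=1}^r\langle P e_i,e_i\rangle$, with $e_i$ the unit element of $G$ placed in the $i$-th summand. Let $dF_f$ be the Borel measure on $\mathbb{R}$ with $dF_f((a,b])=F_f(b)-F_f(a)$ for $a<b$. The Fuglede-Kadison determinant of $f$ is $\det_{\mathcal{N}(G)}(f)=\exp\bigl(\int_{(0,\infty)}\ln(\lambda)\,dF_f(\lambda)\bigr)$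 if this integral converges to a real number, and $0$ otherwise. The operator $f$ is a weak isomorphism if it is injective with dense image. Let $\Lambda(G)$ be the infimum of all values $\det_{\mathcal{N}(G)}(r_A^{(2)})>1$, where $A$ runs through $M_{r,s}(\mathbb{Z}G)$ for all $r,s\ge1$. Let $\Lambda_1(G)$ be the corresponding infimum over $(1,1)$-matrices only, $\Lambda^w(G)$ the one over square matrices $A$ (of any size) for which $r_A^{(2)}$ is a weak isomorphism, and $\Lambda_1^w(G)$ the one over $(1,1)$-matrices $A$ for which $r_A^{(2)}$ is a weak isomorphism. Let $n$ be an odd natural number. Then $$\Lambda^w(\mathbb{Z}/n)=\Lambda_1^w(\mathbb{Z}/n)=2^{1/n}.$$ The infimum is attained: for every generator $t$ of $\mathbb{Z}/n$ the element $t+1\in\mathbb{Z}[\mathbb{Z}/n]$ defines a weak isomorphism $r_{t+1}^{(2)}\colon L^2(\mathbb{Z}/n)\to L^2(\mathbb{Z}/n)$ with $\det_{\mathcal{N}(\mathbb{Z}/n)}(r_{t+1}^{(2)})=2^{1/n}$. Moreover, $$2^{1/(2n)}\le\Lambda(\mathbb{Z}/n)\le\Lambda_1(\mathbb{Z}/n)\le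 2^{1/n}.$$ -/

import Mathlib

noncomputable section

namespace LehmerGroup

open MeasureTheory Set

/-! ### The Hilbert spaces `L²(G)` and `L²(G)^r` -/

/-- The Hilbert space `L²(G)` of square summable families of complex numbers indexed by `G`; the
family `x` stands for the formal sum `∑ x g · g`. -/
abbrev L2 (G : Type*) : Type _ := lp (fun _ : G => ℂ) 2

/-- The Hilbert space direct sum `L²(G)^r`. -/
abbrev L2Pow (G : Type*) (r : ℕ) : Type _ := PiLp 2 (fun _ : Fin r => L2 G)

/-- Right multiplication by a group element `h` on `L²(G)`: the coefficient of `∑ x g · (g h)` at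
`g` is `x (g h⁻¹)`. -/
def rightTranslation {G : Type*} [Group G] (h : G) : L2 G →ₗᵢ[ℂ] L2 G where
  toFun x := ⟨fun g => x (g * h⁻¹), by
    have hx := (memℓp_gen_iff (p := 2) (by norm_num)).1 (lp.memℓp x)
    exact memℓp_gen (hx.comp_injective (mul_left_injective h⁻¹))⟩
  map_add' _ _ := rfl
  map_smul' _ _ := rfl
  norm_map' x := by
    have h2 : 0 < (2 : ENNReal).toReal := by norm_num
    simp only [lp.norm_eq_tsum_rpow h2]
    congr 1
    exact (Equiv.mulRight h⁻¹).tsum_eq (fun g => ‖x g‖ ^ (2 : ENNReal).toReal)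

/-- Right multiplication `L²(G) → L²(G)`, `x ↦ x · a`, by an element `a` of the integral group
ring. -/
def rightMul {G : Type*} [Group G] (a : MonoidAlgebra ℤ G) : L2 G →L[ℂ] L2 G :=
  ∑ h ∈ a.coeff.support, ((a.coeff h : ℤ) : ℂ) • (rightTranslation h).toContinuousLinearMap

/-- The bounded operator `L²(G)^r → L²(G)^s`, `x ↦ (∑ k, x k · A k j)_j`, given by right
multiplication with a matrix `A` over the integral group ring. -/
def rightMulMatrix {G : Type*} [Group G] {r s : ℕ}
    (A : Matrix (Fin r) (Fin s) (MonoidAlgebra ℤ G)) : L2Pow G r →L[ℂ] L2Pow G s :=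
  (PiLp.continuousLinearEquiv 2 ℂ (fun _ : Fin s => L2 G)).symm.toContinuousLinearMap ∘L
    ContinuousLinearMap.pi fun j =>
      ∑ k : Fin r, rightMul (A k j) ∘L PiLp.proj 2 (fun _ : Fin r => L2 G) k

/-! ### Von Neumann dimension, spectral density function, Fuglede-Kadison determinant -/

open Classical in
/-- The unit element `e ∈ G ⊆ L²(G)`, placed in the `i`-th summand of `L²(G)^r`. -/
def unitVec (G : Type*) [Group G] (r : ℕ) (i : Fin r) : L2Pow G r :=
  WithLp.toLp 2 (Pi.single i (lp.single 2 (1 : G) (1 : ℂ)))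

/-- The von Neumann dimension of the image of a `G`-equivariant orthogonal projection `P` of
`L²(G)^r`: the sum of the von Neumann traces `⟨P e, e⟩` of its diagonal entries. -/
def vnDim {G : Type*} [Group G] {r : ℕ} (P : L2Pow G r →L[ℂ] L2Pow G r) : ℝ :=
  ∑ i : Fin r, (inner ℂ (unitVec G r i) (P (unitVec G r i))).re

/-- The spectral projection `E_c = 1_{(-∞, c]}(T)` of a bounded self-adjoint operator `T`: the
orthogonal projection onto the kernel of the positive part `(T - c)₊`. -/
def spectralProjection {H : Type*} [NormedAddCommGroup H] [InnerProductSpace ℂ H]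
    [CompleteSpace H] (T : H →L[ℂ] H) (c : ℝ) : H →L[ℂ] H :=
  (cfc (fun x : ℝ => max (x - c) 0) T).ker.starProjection

/-- The spectral density function `F_f(c) = dim (im E_{c²})` for the spectral projections of
`f* f`, with `F_f(c) = 0` for `c < 0`. -/
def spectralDensity {G : Type*} [Group G] {r s : ℕ} (f : L2Pow G r →L[ℂ] L2Pow G s) (c : ℝ) : ℝ :=
  if 0 ≤ c then vnDim (spectralProjection (f.adjoint ∘L f) (c ^ 2)) else 0

theorem spectralProjection_mono {H : Type*} [NormedAddCommGroup H] [InnerProductSpace ℂ H]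
    [CompleteSpace H] (T : H →L[ℂ] H) : Monotone (spectralProjection T) := by
  intro a b hab
  refine Submodule.starProjection_le_starProjection_iff.2 ?_
  rcases hab.eq_or_lt with rfl | hlt
  · exact le_rfl
  have hfac : (fun x : ℝ => max (x - b) 0) =
      fun x => (max (x - b) 0 / max (x - a) (b - a)) * max (x - a) 0 := by
    funext x
    rcases le_total x b with h | h
    · simp [max_eq_right (sub_nonpos.2 h)]
    · have h1 : 0 < x - a := by linarith
      rw [max_eq_left (show b - a ≤ x - a by linarith), max_eq_left h1.le]
      field_simp
  by_cases hT : IsSelfAdjoint T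
  · have hc : Continuous fun x : ℝ => max (x - b) 0 / max (x - a) (b - a) := by
      refine Continuous.div (by fun_prop) (by fun_prop) fun x => ?_
      exact (lt_max_of_lt_right (sub_pos.2 hlt)).ne'
    rw [hfac, cfc_mul _ _ T hc.continuousOn (by fun_prop)]
    intro v hv
    have hv' : cfc (fun x : ℝ => max (x - a) 0) T v = 0 := hv
    change (cfc _ T) (cfc (fun x : ℝ => max (x - a) 0) T v) = 0
    rw [hv', map_zero]
  · rw [cfc_apply_of_not_predicate T hT, cfc_apply_of_not_predicate T hT]

theorem re_inner_spectralProjection_nonneg {H : Type*} [NormedAddCommGroup H]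
    [InnerProductSpace ℂ H] [CompleteSpace H] (T : H →L[ℂ] H) (c : ℝ) (v : H) :
    0 ≤ (inner ℂ v (spectralProjection T c v)).re := by
  have h := Submodule.re_inner_starProjection_nonneg (cfc (fun x : ℝ => max (x - c) 0) T).ker v
  rw [spectralProjection, ← Submodule.inner_starProjection_left_eq_right]
  exact h

theorem spectralDensity_mono {G : Type*} [Group G] {r s : ℕ} (f : L2Pow G r →L[ℂ] L2Pow G s) :
    Monotone (spectralDensity f) := by
  have key : ∀ P Q : L2Pow G r →L[ℂ] L2Pow G r, P ≤ Q → vnDim P ≤ vnDim Q := by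
    intro P Q h
    refine Finset.sum_le_sum fun i _ => ?_
    have h0 := ((ContinuousLinearMap.le_def _ _).1 h).re_inner_nonneg_right (unitVec G r i)
    simpa [inner_sub_right] using h0
  intro a b hab
  unfold spectralDensity
  split_ifs with ha hb hb
  · exact key _ _ (spectralProjection_mono _ (by gcongr))
  · exact absurd (ha.trans hab) hb
  · refine Finset.sum_nonneg fun i _ => ?_
    exact re_inner_spectralProjection_nonneg _ _ _
  · exact le_rfl

/-- The measure `dF` on `ℝ` with `dF (a, b] = F b - F a`, for the spectral density function `F` of
`f` (which is monotone and right-continuous, so that it is its own right limit). -/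
def spectralMeasure {G : Type*} [Group G] {r s : ℕ} (f : L2Pow G r →L[ℂ] L2Pow G s) : Measure ℝ :=
  (spectralDensity_mono f).stieltjesFunction.measure

open Classical in
/-- The Fuglede-Kadison determinant of `f`: it is `exp (∫_{0+}^∞ ln c dF(c))` if the integral
converges to a real number, and `0` otherwise. -/
def fkDet {G : Type*} [Group G] {r s : ℕ} (f : L2Pow G r →L[ℂ] L2Pow G s) : ℝ :=
  if IntegrableOn Real.log (Ioi 0) (spectralMeasure f) then
    Real.exp (∫ c in Ioi 0, Real.log c ∂(spectralMeasure f))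
  else 0

/-- A weak isomorphism: an injective operator with dense image. -/
def IsWeakIso {G : Type*} [Group G] {r s : ℕ} (f : L2Pow G r →L[ℂ] L2Pow G s) : Prop :=
  Function.Injective f ∧ DenseRange f

/-! ### Lehmer's constants of a group

The sets below contain the determinant `2` of the `(1,1)`-matrix `2` and are bounded below by `1`,
so the infima are honest ones. -/

/-- `Λ(G)`: all matrices over the integral group ring. -/
def lehmer (G : Type*) [Group G] : ℝ :=
  sInf {d : ℝ | 1 < d ∧ ∃ (r s : ℕ) (A : Matrix (Fin r) (Fin s) (MonoidAlgebra ℤ G)),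
    1 ≤ r ∧ 1 ≤ s ∧ fkDet (rightMulMatrix A) = d}

/-- `Λ₁(G)`: only `(1,1)`-matrices. -/
def lehmerOne (G : Type*) [Group G] : ℝ :=
  sInf {d : ℝ | 1 < d ∧ ∃ A : Matrix (Fin 1) (Fin 1) (MonoidAlgebra ℤ G),
    fkDet (rightMulMatrix A) = d}

/-- `Λ^w(G)`: only square matrices that induce a weak isomorphism. -/
def lehmerW (G : Type*) [Group G] : ℝ :=
  sInf {d : ℝ | 1 < d ∧ ∃ (r : ℕ) (A : Matrix (Fin r) (Fin r) (MonoidAlgebra ℤ G)),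
    1 ≤ r ∧ IsWeakIso (rightMulMatrix A) ∧ fkDet (rightMulMatrix A) = d}

/-- `Λ₁^w(G)`: only `(1,1)`-matrices that induce a weak isomorphism. -/
def lehmerOneW (G : Type*) [Group G] : ℝ :=
  sInf {d : ℝ | 1 < d ∧ ∃ A : Matrix (Fin 1) (Fin 1) (MonoidAlgebra ℤ G),
    IsWeakIso (rightMulMatrix A) ∧ fkDet (rightMulMatrix A) = d}

end LehmerGroup

end

/-! Let `G` be finite. The spectral density function of an equivariant operator `f` on `L²(G)^r` is
a step function: each singular value of `f`, counted with multiplicity, contributes a jump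
`1 / |G|`. Hence `fkDet f` is the `|G|`-th root of the product of the nonzero singular values.
The square of that product is, up to sign, the lowest nonzero coefficient of the characteristic
polynomial of `f* f`, hence an integer when `f` comes from a matrix over `ℤ[G]`; so `fkDet f > 1`
forces `fkDet f ≥ 2 ^ (1 / (2 |G|))`. If `f` is moreover a weak isomorphism, the product itself is
`|det f|`, a positive integer, and `fkDet f > 1` forces `fkDet f ≥ 2 ^ (1 / |G|)`. A generator `t`
of a cyclic group attains this bound: `t + 1` acts by `1 + P` with `P` the permutation matrix of a
`|G|`-cycle, so its determinant is `1 + sign P`, which is `2` if `|G|` is odd. -/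

noncomputable section

namespace LehmerGroup

open MeasureTheory Set Filter Topology

section SpectralProjection

variable {H : Type*} [NormedAddCommGroup H] [InnerProductSpace ℂ H] [CompleteSpace H]
  {T : H →L[ℂ] H}

theorem ofReal_mem_spectrum_of_apply_eq_smul {μ : ℝ} {x : H} (hx : T x = (μ : ℂ) • x)
    (hx0 : x ≠ 0) : μ ∈ spectrum ℝ T := by
  rintro hunit
  have hker : (algebraMap ℝ (H →L[ℂ] H) μ - T) x = 0 := by
    simp [Algebra.algebraMap_eq_smul_one, hx]
  exact hx0 ((ContinuousLinearMap.isUnit_iff_bijective.1 hunit).1 (hker.trans (map_zero _).symm))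

theorem cfc_apply_of_apply_eq_smul (hT : IsSelfAdjoint T) {g : ℝ → ℝ}
    (hg : ContinuousOn g (spectrum ℝ T)) {μ : ℝ} {x : H} (hx : T x = (μ : ℂ) • x) :
    cfc g T x = (g μ : ℂ) • x := by
  rcases eq_or_ne x 0 with rfl | hx0
  · simp
  have hμ : μ ∈ spectrum ℝ T := ofReal_mem_spectrum_of_apply_eq_smul hx hx0
  suffices h : ∀ φ : C(spectrum ℝ T, ℝ), cfcHom hT φ x = (φ ⟨μ, hμ⟩ : ℂ) • x by
    rw [cfc_apply g T hT hg]
    exact h _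
  intro φ
  induction φ using ContinuousMap.induction_on_of_compact with
  | const r =>
    change cfcHom hT (algebraMap ℝ C(spectrum ℝ T, ℝ) r) x = (r : ℂ) • x
    rw [AlgHomClass.commutes, Algebra.algebraMap_eq_smul_one]
    exact (Complex.coe_smul r x).symm
  | id => simpa [cfcHom_id] using hx
  | star_id => simpa [map_star, cfcHom_id, hT.star_eq] using hx
  | add φ ψ hφ hψ => simp [hφ, hψ, add_smul]
  | mul φ ψ hφ hψ =>
    simp only [map_mul, mul_apply_eq_comp, hψ, map_smul, hφ, smul_smul, ContinuousMap.mul_apply,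
      Complex.ofReal_mul, mul_comm]
  | frequently φ hφ =>
    have hclosed : IsClosed {ψ : C(spectrum ℝ T, ℝ) | cfcHom hT ψ x = (ψ ⟨μ, hμ⟩ : ℂ) • x} :=
      isClosed_eq (((ContinuousLinearMap.apply ℂ H x).continuous).comp (cfcHom_continuous hT))
        (by fun_prop)
    exact hclosed.mem_of_frequently_of_tendsto hφ tendsto_id

theorem spectralProjection_apply_of_apply_eq_smul (hT : IsSelfAdjoint T) (c : ℝ) {μ : ℝ} {x : H}
    (hx : T x = (μ : ℂ) • x) : spectralProjection T c x = if μ ≤ c then x else 0 := by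
  set Q : H →L[ℂ] H := cfc (fun y : ℝ => max (y - c) 0) T
  have hQx : Q x = ((max (μ - c) 0 : ℝ) : ℂ) • x :=
    cfc_apply_of_apply_eq_smul hT (by fun_prop) hx
  change Q.ker.starProjection x = _
  split_ifs with hμc
  · rw [Submodule.starProjection_eq_self_iff]
    simpa [max_eq_right (sub_nonpos.2 hμc)] using hQx
  · rw [Submodule.starProjection_apply_eq_zero_iff]
    intro y hy
    have hpos : ((max (μ - c) 0 : ℝ) : ℂ) ≠ 0 := by
      rw [max_eq_left (by linarith)]
      exact_mod_cast (sub_pos.2 (not_le.1 hμc)).ne'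
    have hQ : IsSelfAdjoint Q := cfc_predicate _ _
    have horth : inner ℂ y (Q x) = 0 := by
      rw [← ContinuousLinearMap.adjoint_inner_left, hQ.adjoint_eq, show Q y = 0 from hy,
        inner_zero_left]
    rw [hQx, inner_smul_right] at horth
    exact (mul_eq_zero.1 horth).resolve_left hpos

theorem spectralProjection_apply_comm (hT : IsSelfAdjoint T) (c : ℝ) (U : H ≃ₗᵢ[ℂ] H)
    (hU : ∀ x, T (U x) = U (T x)) (x : H) :
    spectralProjection T c (U x) = U (spectralProjection T c x) := by
  set Q : H →L[ℂ] H := cfc (fun y : ℝ => max (y - c) 0) T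
  set V : H →L[ℂ] H := U.toContinuousLinearEquiv.toContinuousLinearMap
  have hQV : Commute Q V := hT.commute_cfc (ContinuousLinearMap.ext hU : T * V = V * T) _
  have hQU : ∀ y, Q (U y) = U (Q y) := fun y => congrArg (fun S : H →L[ℂ] H => S y) hQV.eq
  have hker : Q.ker.map U.toLinearEquiv.toLinearMap = Q.ker := by
    ext y
    rw [Submodule.mem_map_equiv]
    change Q (U.symm y) = 0 ↔ Q y = 0
    rw [← U.map_eq_zero_iff, ← hQU, U.apply_symm_apply]
  change Q.ker.starProjection (U x) = U (Q.ker.starProjection x)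
  simpa only [hker, U.symm_apply_apply] using Submodule.starProjection_map_apply U Q.ker (U x)

theorem trace_spectralProjection [FiniteDimensional ℂ H] (hT : T.toLinearMap.IsSymmetric) {m : ℕ}
    (hm : Module.finrank ℂ H = m) (c : ℝ) :
    LinearMap.trace ℂ H (spectralProjection T c).toLinearMap =
      ∑ i, if hT.eigenvalues hm i ≤ c then 1 else 0 := by
  have hsa : IsSelfAdjoint T := ContinuousLinearMap.isSelfAdjoint_iff_isSymmetric.2 hT
  rw [LinearMap.trace_eq_sum_inner _ (hT.eigenvectorBasis hm)]
  refine Finset.sum_congr rfl fun i _ => ?_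
  have hi : T (hT.eigenvectorBasis hm i) = (hT.eigenvalues hm i : ℂ) • hT.eigenvectorBasis hm i :=
    hT.apply_eigenvectorBasis hm i
  rw [ContinuousLinearMap.coe_coe, spectralProjection_apply_of_apply_eq_smul hsa c hi]
  split_ifs <;> simp

theorem isSelfAdjoint_adjoint_comp_self {K : Type*} [NormedAddCommGroup K] [InnerProductSpace ℂ K]
    [CompleteSpace K] (f : H →L[ℂ] K) : IsSelfAdjoint (f.adjoint ∘L f) :=
  (ContinuousLinearMap.isPositive_adjoint_comp_self f).isSelfAdjoint

theorem trace_spectralProjection_adjoint_comp_self [FiniteDimensional ℂ H] {K : Type*}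
    [NormedAddCommGroup K] [InnerProductSpace ℂ K] [FiniteDimensional ℂ K] [CompleteSpace K]
    (f : H →L[ℂ] K) {m : ℕ} (hm : Module.finrank ℂ H = m) {c : ℝ} (hc : 0 ≤ c) :
    LinearMap.trace ℂ H (spectralProjection (f.adjoint ∘L f) (c ^ 2)).toLinearMap =
      ∑ i : Fin m, if f.toLinearMap.singularValues i ≤ c then 1 else 0 := by
  have hsymm : (f.adjoint ∘L f).toLinearMap.IsSymmetric :=
    f.toLinearMap.isSymmetric_adjoint_comp_self
  have hσ : ∀ i : Fin m, f.toLinearMap.singularValues i ^ 2 = hsymm.eigenvalues hm i :=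
    f.toLinearMap.sq_singularValues_fin hm
  simp only [trace_spectralProjection hsymm hm, ← hσ,
    sq_le_sq₀ (f.toLinearMap.singularValues_nonneg _) hc]

end SpectralProjection

section Atoms

theorem tendsto_measureReal_Iic_nhdsGT (μ : Measure ℝ) [IsFiniteMeasure μ] (a : ℝ) :
    Tendsto (fun c => μ.real (Iic c)) (𝓝[>] a) (𝓝 (μ.real (Iic a))) := by
  have hinter : ⋂ c > a, Iic c = Iic a := by
    ext x
    simp only [mem_iInter, mem_Iic]
    exact forall_gt_imp_ge_iff_le_of_dense
  have h := tendsto_measure_biInter_gt (μ := μ) (s := Iic) (a := a)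
    (fun _ _ => measurableSet_Iic.nullMeasurableSet) (fun _ _ _ => Iic_subset_Iic.2)
    ⟨a + 1, by simp, measure_ne_top _ _⟩
  rw [hinter] at h
  exact (ENNReal.tendsto_toReal (measure_ne_top _ _)).comp h

theorem stieltjesFunction_measure_eq {F : ℝ → ℝ} (hF : Monotone F) (μ : Measure ℝ)
    [IsFiniteMeasure μ] (h : ∀ c, F c = μ.real (Iic c)) : hF.stieltjesFunction.measure = μ := by
  obtain rfl : F = fun c => μ.real (Iic c) := funext h
  have hright : ∀ c, hF.stieltjesFunction c = μ.real (Iic c) := fun c => by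
    rw [hF.stieltjesFunction_eq]
    exact rightLim_eq_of_tendsto (tendsto_measureReal_Iic_nhdsGT μ c)
  refine Measure.ext_of_Ioc _ _ fun a b hab => ?_
  rw [StieltjesFunction.measure_Ioc, hright, hright,
    ← measureReal_sdiff (Iic_subset_Iic.2 hab.le) measurableSet_Iic, Iic_sdiff_Iic,
    ofReal_measureReal]

variable {ι : Type*} [Fintype ι]

theorem integrableOn_log_sum_dirac (a : ENNReal) (ha : a ≠ ⊤) (x : ι → ℝ) (s : Set ℝ) :
    IntegrableOn Real.log s (a • ∑ i, Measure.dirac (x i)) :=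
  ((integrable_finsetSum_measure.2 fun _ _ => integrable_dirac (by simp)).smul_measure
    ha).integrableOn

-- Atoms at `0` are missing on the left; they contribute nothing on the right, as `log 0 = 0`.
theorem setIntegral_log_sum_dirac (a : ENNReal) {x : ι → ℝ} (hx : ∀ i, 0 ≤ x i) :
    ∫ c in Ioi 0, Real.log c ∂(a • ∑ i, Measure.dirac (x i)) =
      a.toReal * ∑ i, Real.log (x i) := by
  rw [← integral_indicator measurableSet_Ioi, integral_smul_measure, integral_finsetSum_measure
    fun _ _ => integrable_dirac (by simp), smul_eq_mul]
  refine congrArg _ (Finset.sum_congr rfl fun i _ => ?_)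
  rw [integral_dirac]
  rcases (hx i).eq_or_lt with h | h
  · simp [← h]
  · simp [h]

end Atoms

section TrailingCoeff

open Polynomial

theorem trailingCoeff_map_of_injective {R S : Type*} [Semiring R] [Semiring S] {φ : R →+* S}
    (hφ : Function.Injective φ) (p : R[X]) : (p.map φ).trailingCoeff = φ p.trailingCoeff := by
  simp only [trailingCoeff, coeff_map, natTrailingDegree, trailingDegree,
    support_map_of_injective p hφ]

open Classical in
theorem trailingCoeff_X_sub_C {R : Type*} [Ring R] (a : R) :
    (X - C a).trailingCoeff = if a = 0 then 1 else -a := by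
  nontriviality R
  split_ifs with h
  · simp [h, trailingCoeff]
  · rw [trailingCoeff_eq_coeff_zero (by simpa using h)]
    simp

theorem trailingCoeff_prod {R ι : Type*} [CommSemiring R] [NoZeroDivisors R] (s : Finset ι)
    (p : ι → R[X]) : (∏ i ∈ s, p i).trailingCoeff = ∏ i ∈ s, (p i).trailingCoeff := by
  classical
  induction s using Finset.induction_on with
  | empty => simp [trailingCoeff]
  | insert i s hi ih => rw [Finset.prod_insert hi, trailingCoeff_mul, ih, Finset.prod_insert hi]

-- The roots `0` drop out on both sides, since `log 0 = 0`.
theorem log_norm_trailingCoeff_prod_X_sub_C {𝕜 ι : Type*} [RCLike 𝕜] [Fintype ι] (μ : ι → 𝕜) :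
    Real.log ‖(∏ i, (X - C (μ i))).trailingCoeff‖ = ∑ i, Real.log ‖μ i‖ := by
  rw [trailingCoeff_prod, norm_prod, Real.log_prod]
  · refine Finset.sum_congr rfl fun i _ => ?_
    rw [trailingCoeff_X_sub_C]
    by_cases h : μ i = 0 <;> simp [h]
  · intro i _
    rw [norm_ne_zero_iff, trailingCoeff_nonzero_iff_nonzero]
    exact X_sub_C_ne_zero _

end TrailingCoeff

section PseudoDet

open Module

variable {𝕜 E F : Type*} [RCLike 𝕜]
  [NormedAddCommGroup E] [InnerProductSpace 𝕜 E] [FiniteDimensional 𝕜 E]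
  [NormedAddCommGroup F] [InnerProductSpace 𝕜 F] [FiniteDimensional 𝕜 F]

/-- The product of the nonzero singular values of `T`, counted with multiplicity (and `1` for
`T = 0`). -/
def pseudoDet (T : E →ₗ[𝕜] F) : ℝ :=
  T.singularValues.prod fun _ σ => σ

theorem pseudoDet_pos (T : E →ₗ[𝕜] F) : 0 < pseudoDet T :=
  Finset.prod_pos fun i hi => (T.singularValues_pos_iff_ne_zero i).2 (Finsupp.mem_support_iff.1 hi)

theorem log_pseudoDet (T : E →ₗ[𝕜] F) :
    Real.log (pseudoDet T) = ∑ i : Fin (finrank 𝕜 E), Real.log (T.singularValues i) := by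
  rw [pseudoDet, Finsupp.prod, Real.log_prod fun i hi => Finsupp.mem_support_iff.1 hi,
    T.support_singularValues, Fin.sum_univ_eq_sum_range fun i => Real.log (T.singularValues i)]
  refine Finset.sum_subset (Finset.range_mono T.finrank_range_le) fun i _ hi => ?_
  rw [Finset.mem_range, not_lt, ← T.singularValues_eq_zero_iff_le_finrank_range] at hi
  rw [hi, Real.log_zero]

theorem pseudoDet_sq (T : E →ₗ[𝕜] F) :
    pseudoDet T ^ 2 = ‖(T.adjoint ∘ₗ T).charpoly.trailingCoeff‖ := by
  have hpos : 0 < ‖(T.adjoint ∘ₗ T).charpoly.trailingCoeff‖ := norm_pos_iff.2 <|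
    Polynomial.trailingCoeff_nonzero_iff_nonzero.2 (LinearMap.charpoly_monic _).ne_zero
  refine Real.log_injOn_pos (pow_pos (pseudoDet_pos T) 2) hpos ?_
  rw [T.isSymmetric_adjoint_comp_self.charpoly_eq rfl, log_norm_trailingCoeff_prod_X_sub_C,
    Real.log_pow, log_pseudoDet, Finset.mul_sum]
  refine Finset.sum_congr rfl fun i _ => ?_
  rw [← T.sq_singularValues_fin rfl i, ← Real.log_pow]
  simp

theorem pseudoDet_eq_normDet {T : E →ₗ[𝕜] F} (hT : Function.Injective T) :
    pseudoDet T = T.normDet := by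
  rw [pseudoDet, Finsupp.prod, T.support_singularValues, T.normDet_eq_prod_singularValues,
    LinearMap.finrank_range_of_inj hT]

theorem exists_natCast_eq_pseudoDet_sq {ι κ : Type*} [Fintype ι] [DecidableEq ι] [Fintype κ]
    (b : OrthonormalBasis ι 𝕜 E) (c : OrthonormalBasis κ 𝕜 F) {T : E →ₗ[𝕜] F}
    {M : Matrix κ ι ℤ}
    (hM : LinearMap.toMatrix b.toBasis c.toBasis T = M.map (Int.castRingHom 𝕜)) :
    ∃ k : ℕ, pseudoDet T ^ 2 = k := by
  classical
  have hgram : LinearMap.toMatrix b.toBasis b.toBasis (T.adjoint ∘ₗ T) =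
      (M.transpose * M).map (Int.castRingHom 𝕜) := by
    rw [LinearMap.toMatrix_comp _ c.toBasis, LinearMap.toMatrix_adjoint, hM, Matrix.map_mul]
    congr 1
    ext p q
    simp
  refine ⟨(M.transpose * M).charpoly.trailingCoeff.natAbs, ?_⟩
  rw [pseudoDet_sq, ← LinearMap.charpoly_toMatrix _ b.toBasis, hgram, Matrix.charpoly_map,
    trailingCoeff_map_of_injective (RingHom.injective_int _), eq_intCast, ← RCLike.ofReal_intCast,
    RCLike.norm_ofReal, Nat.cast_natAbs, Int.cast_abs]

end PseudoDet

section Equivariant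

/-- The isometry `L²(β) ≃ L²(α)`, `x ↦ x ∘ e`, induced by a bijection `e : α ≃ β`. -/
def reindex {α β : Type*} (e : α ≃ β) : L2 β ≃ₗᵢ[ℂ] L2 α where
  toFun x := ⟨fun a => x (e a), memℓp_gen
    (((memℓp_gen_iff (p := 2) (by norm_num)).1 (lp.memℓp x)).comp_injective e.injective)⟩
  invFun x := ⟨fun b => x (e.symm b), memℓp_gen
    (((memℓp_gen_iff (p := 2) (by norm_num)).1 (lp.memℓp x)).comp_injective e.symm.injective)⟩
  map_add' _ _ := rfl
  map_smul' _ _ := rfl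
  left_inv x := lp.ext (funext fun b => congrArg x (e.apply_symm_apply b))
  right_inv x := lp.ext (funext fun a => congrArg x (e.symm_apply_apply a))
  norm_map' x := by
    simp only [lp.norm_eq_tsum_rpow (p := 2) (by norm_num)]
    exact congrArg (· ^ _) (e.tsum_eq fun b => ‖x b‖ ^ (2 : ENNReal).toReal)

variable {G : Type*} [Group G] {r s u : ℕ}

/-- Left multiplication by `g` on `L²(G)^r`: the coefficient of `∑ x h · (g h)` at `h` is
`x (g⁻¹ h)`. -/
def leftTranslation (r : ℕ) (g : G) : L2Pow G r ≃ₗᵢ[ℂ] L2Pow G r :=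
  LinearIsometryEquiv.piLpCongrRight 2 fun _ => reindex (Equiv.mulLeft g⁻¹)

theorem leftTranslation_apply (g : G) (x : L2Pow G r) (i : Fin r) (h : G) :
    leftTranslation r g x i h = x i (g⁻¹ * h) :=
  rfl

/-- A `G`-equivariant operator `L²(G)^r → L²(G)^s`: one that commutes with left multiplication by
the elements of `G`. -/
def IsEquivariant (f : L2Pow G r →L[ℂ] L2Pow G s) : Prop :=
  ∀ g x, f (leftTranslation r g x) = leftTranslation s g (f x)

theorem IsEquivariant.comp {f' : L2Pow G s →L[ℂ] L2Pow G u} {f : L2Pow G r →L[ℂ] L2Pow G s}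
    (hf' : IsEquivariant f') (hf : IsEquivariant f) : IsEquivariant (f' ∘L f) := fun g x => by
  rw [ContinuousLinearMap.comp_apply, hf, hf', ContinuousLinearMap.comp_apply]

theorem IsEquivariant.adjoint {f : L2Pow G r →L[ℂ] L2Pow G s} (hf : IsEquivariant f) :
    IsEquivariant f.adjoint := fun g x => by
  refine ext_inner_right ℂ fun y => ?_
  obtain ⟨y, rfl⟩ := (leftTranslation r g).surjective y
  rw [ContinuousLinearMap.adjoint_inner_left, LinearIsometryEquiv.inner_map_map, hf,
    LinearIsometryEquiv.inner_map_map, ContinuousLinearMap.adjoint_inner_left]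

theorem IsEquivariant.spectralProjection {T : L2Pow G r →L[ℂ] L2Pow G r} (hT : IsEquivariant T)
    (hsa : IsSelfAdjoint T) (c : ℝ) : IsEquivariant (spectralProjection T c) := fun g x =>
  spectralProjection_apply_comm hsa c (leftTranslation r g) (hT g) x

theorem rightMul_apply (a : MonoidAlgebra ℤ G) (x : L2 G) (g : G) :
    rightMul a x g = ∑ h ∈ a.coeff.support, (a.coeff h : ℂ) * x (g * h⁻¹) := by
  simp only [rightMul, sum_apply, lp.coeFn_sum, Finset.sum_apply]
  rfl

theorem rightMulMatrix_apply_apply (A : Matrix (Fin r) (Fin s) (MonoidAlgebra ℤ G))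
    (x : L2Pow G r) (j : Fin s) (g : G) :
    rightMulMatrix A x j g =
      ∑ k, ∑ h ∈ (A k j).coeff.support, ((A k j).coeff h : ℂ) * x k (g * h⁻¹) := by
  have hj : rightMulMatrix A x j = ∑ k, rightMul (A k j) (x k) := by simp [rightMulMatrix]
  simp only [hj, lp.coeFn_sum, Finset.sum_apply, rightMul_apply]

theorem isEquivariant_rightMulMatrix (A : Matrix (Fin r) (Fin s) (MonoidAlgebra ℤ G)) :
    IsEquivariant (rightMulMatrix A) := fun g x => by
  ext j h
  simp only [rightMulMatrix_apply_apply, leftTranslation_apply, mul_assoc]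

end Equivariant

section FiniteGroup

variable {G : Type*} {r s : ℕ}

/-- The orthonormal basis of `L²(G)^r` given by the elements of `G` in the summands. -/
def stdBasis (G : Type*) [Fintype G] (r : ℕ) : OrthonormalBasis (Fin r × G) ℂ (L2Pow G r) :=
  (Pi.orthonormalBasis fun _ : Fin r =>
    OrthonormalBasis.ofRepr (lpPiLpₗᵢ (fun _ : G => ℂ) ℂ)).reindex (Equiv.sigmaEquivProd _ _)

theorem stdBasis_repr_apply [Fintype G] (x : L2Pow G r) (p : Fin r × G) :
    (stdBasis G r).repr x p = x p.1 p.2 :=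
  rfl

instance finiteDimensional_L2Pow [Finite G] : FiniteDimensional ℂ (L2Pow G r) :=
  have := Fintype.ofFinite G
  (stdBasis G r).toBasis.finiteDimensional_of_finite

variable [Group G]

theorem unitVec_eq_stdBasis [Fintype G] (i : Fin r) : unitVec G r i = stdBasis G r (i, 1) := by
  classical
  refine (stdBasis G r).repr.injective (PiLp.ext fun p => ?_)
  rw [OrthonormalBasis.repr_self, stdBasis_repr_apply]
  obtain ⟨j, h⟩ := p
  rcases eq_or_ne j i with rfl | hj
  · simp [unitVec, Pi.single_apply]
  · simp [unitVec, hj]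

theorem leftTranslation_stdBasis [Fintype G] (g : G) (p : Fin r × G) :
    leftTranslation r g (stdBasis G r p) = stdBasis G r (p.1, g * p.2) := by
  classical
  refine (stdBasis G r).repr.injective (PiLp.ext fun q => ?_)
  rw [stdBasis_repr_apply, leftTranslation_apply, ← stdBasis_repr_apply _ (q.1, g⁻¹ * q.2),
    OrthonormalBasis.repr_self, OrthonormalBasis.repr_self]
  simp only [PiLp.single_apply, Prod.ext_iff, inv_mul_eq_iff_eq_mul]

variable [Finite G]

theorem vnDim_eq_re_trace_div_card {P : L2Pow G r →L[ℂ] L2Pow G r} (hP : IsEquivariant P) :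
    vnDim P = (LinearMap.trace ℂ _ P.toLinearMap).re / Nat.card G := by
  have := Fintype.ofFinite G
  have hdiag : ∀ (i : Fin r) (g : G), inner ℂ (stdBasis G r (i, g)) (P (stdBasis G r (i, g))) =
      inner ℂ (unitVec G r i) (P (unitVec G r i)) := fun i g => by
    have hg : stdBasis G r (i, g) = leftTranslation r g (unitVec G r i) := by
      rw [unitVec_eq_stdBasis, leftTranslation_stdBasis, mul_one]
    rw [hg, hP, LinearIsometryEquiv.inner_map_map]
  rw [eq_div_iff (by exact_mod_cast Nat.card_pos.ne'),
    LinearMap.trace_eq_sum_inner _ (stdBasis G r), Complex.re_sum, Fintype.sum_prod_type, vnDim,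
    Finset.sum_mul]
  simp [hdiag, mul_comm]

variable {f : L2Pow G r →L[ℂ] L2Pow G s}

theorem spectralDensity_eq (hf : IsEquivariant f) {m : ℕ}
    (hm : Module.finrank ℂ (L2Pow G r) = m) (c : ℝ) :
    spectralDensity f c =
      (∑ i : Fin m, if f.toLinearMap.singularValues i ≤ c then 1 else 0) / Nat.card G := by
  rw [spectralDensity]
  split_ifs with hc
  · rw [vnDim_eq_re_trace_div_card
      ((hf.adjoint.comp hf).spectralProjection (isSelfAdjoint_adjoint_comp_self f) _),
      trace_spectralProjection_adjoint_comp_self f hm hc, Complex.re_sum]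
    simp only [apply_ite Complex.re, Complex.one_re, Complex.zero_re]
  · have hσ : ∀ i : Fin m, ¬ f.toLinearMap.singularValues i ≤ c := fun i hi =>
      hc ((LinearMap.singularValues_nonneg _ _).trans hi)
    simp [hσ]

theorem spectralMeasure_eq (hf : IsEquivariant f) {m : ℕ}
    (hm : Module.finrank ℂ (L2Pow G r) = m) :
    spectralMeasure f = (Nat.card G : ENNReal)⁻¹ •
      ∑ i : Fin m, Measure.dirac (f.toLinearMap.singularValues i) := by
  have hcard : (Nat.card G : ENNReal)⁻¹ ≠ ⊤ := by simp [Nat.card_pos.ne']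
  have := Measure.smul_finite
    (∑ i : Fin m, Measure.dirac (f.toLinearMap.singularValues i)) hcard
  refine stieltjesFunction_measure_eq _ _ fun c => ?_
  rw [spectralDensity_eq hf hm, measureReal_ennreal_smul_apply, measureReal_def,
    Measure.finsetSum_apply, ENNReal.toReal_sum fun _ _ => measure_ne_top _ _, div_eq_inv_mul]
  simp [Measure.dirac_apply' _ measurableSet_Iic, indicator_apply, apply_ite ENNReal.toReal]

theorem fkDet_eq_pseudoDet_rpow (hf : IsEquivariant f) :
    fkDet f = pseudoDet f.toLinearMap ^ (1 / (Nat.card G : ℝ)) := by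
  have hcard : (Nat.card G : ENNReal)⁻¹ ≠ ⊤ := by simp [Nat.card_pos.ne']
  rw [fkDet, spectralMeasure_eq hf rfl, if_pos (integrableOn_log_sum_dirac _ hcard _ _),
    setIntegral_log_sum_dirac _ fun i => LinearMap.singularValues_nonneg _ _, ← log_pseudoDet,
    Real.rpow_def_of_pos (pseudoDet_pos _)]
  simp [mul_comm]

theorem isWeakIso_iff_det_ne_zero {f : L2Pow G r →L[ℂ] L2Pow G r} :
    IsWeakIso f ↔ LinearMap.det f.toLinearMap ≠ 0 := by
  have hinj : Function.Injective f.toLinearMap ↔ LinearMap.det f.toLinearMap ≠ 0 := by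
    rw [← LinearMap.ker_eq_bot, ← LinearMap.isUnit_iff_ker_eq_bot,
      LinearMap.isUnit_iff_isUnit_det, isUnit_iff_ne_zero]
  refine ⟨fun h => hinj.1 h.1, fun h => ⟨hinj.2 h, ?_⟩⟩
  exact (LinearMap.injective_iff_surjective.1 (hinj.2 h)).denseRange

end FiniteGroup

section IntegerMatrix

variable {G : Type*} [Group G] {r s : ℕ}

/-- The matrix of `rightMulMatrix A` in the standard bases; its entries are integers, since `q · a`
has coefficient `a (q⁻¹ p)` at `p`. -/
def intMatrix (A : Matrix (Fin r) (Fin s) (MonoidAlgebra ℤ G)) :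
    Matrix (Fin s × G) (Fin r × G) ℤ :=
  Matrix.of fun p q => (A q.1 p.1).coeff (q.2⁻¹ * p.2)

theorem rightMulMatrix_apply_eq_sum_intMatrix [Fintype G]
    (A : Matrix (Fin r) (Fin s) (MonoidAlgebra ℤ G)) (x : L2Pow G r) (p : Fin s × G) :
    rightMulMatrix A x p.1 p.2 = ∑ q, (intMatrix A p q : ℂ) * x q.1 q.2 := by
  rw [rightMulMatrix_apply_apply, Fintype.sum_prod_type]
  refine Finset.sum_congr rfl fun k _ => ?_
  rw [Finset.sum_subset (Finset.subset_univ _) fun h _ hh => by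
    rw [Finsupp.notMem_support_iff.1 hh, Int.cast_zero, zero_mul]]
  exact Fintype.sum_equiv ((Equiv.inv G).trans (Equiv.mulLeft p.2)) _ _ fun h => by
    simp [intMatrix]

variable [Fintype G] [DecidableEq G]

theorem toMatrix_rightMulMatrix (A : Matrix (Fin r) (Fin s) (MonoidAlgebra ℤ G)) :
    LinearMap.toMatrix (stdBasis G r).toBasis (stdBasis G s).toBasis
      (rightMulMatrix A).toLinearMap = (intMatrix A).map (Int.castRingHom ℂ) := by
  ext p q
  rw [LinearMap.toMatrix_apply, OrthonormalBasis.coe_toBasis_repr_apply, stdBasis_repr_apply,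
    OrthonormalBasis.coe_toBasis, ContinuousLinearMap.coe_coe,
    rightMulMatrix_apply_eq_sum_intMatrix]
  simp only [← stdBasis_repr_apply, OrthonormalBasis.repr_self, PiLp.single_apply]
  simp

theorem det_rightMulMatrix (A : Matrix (Fin r) (Fin r) (MonoidAlgebra ℤ G)) :
    LinearMap.det (rightMulMatrix A).toLinearMap = ((intMatrix A).det : ℂ) := by
  rw [← LinearMap.det_toMatrix (stdBasis G r).toBasis, toMatrix_rightMulMatrix,
    ← RingHom.mapMatrix_apply, ← RingHom.map_det, eq_intCast]

theorem isWeakIso_rightMulMatrix_iff {A : Matrix (Fin r) (Fin r) (MonoidAlgebra ℤ G)} :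
    IsWeakIso (rightMulMatrix A) ↔ (intMatrix A).det ≠ 0 := by
  rw [isWeakIso_iff_det_ne_zero, det_rightMulMatrix, Int.cast_ne_zero]

theorem fkDet_rightMulMatrix_of_isWeakIso {A : Matrix (Fin r) (Fin r) (MonoidAlgebra ℤ G)}
    (hA : IsWeakIso (rightMulMatrix A)) :
    fkDet (rightMulMatrix A) = ((intMatrix A).det.natAbs : ℝ) ^ (1 / (Nat.card G : ℝ)) := by
  rw [fkDet_eq_pseudoDet_rpow (isEquivariant_rightMulMatrix A), pseudoDet_eq_normDet hA.1,
    LinearMap.normDet_eq_norm_det, det_rightMulMatrix, Complex.norm_intCast, Nat.cast_natAbs,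
    Int.cast_abs]

end IntegerMatrix

section LowerBound

theorem two_rpow_le_natCast_rpow {k : ℕ} {y : ℝ} (hy : 0 ≤ y) (h : 1 < (k : ℝ) ^ y) :
    (2 : ℝ) ^ y ≤ (k : ℝ) ^ y := by
  have hk : 1 < k := by
    by_contra! hk
    exact (Real.rpow_le_one k.cast_nonneg (by exact_mod_cast hk) hy).not_gt h
  gcongr
  exact_mod_cast hk

variable {G : Type*} [Group G] [Finite G] {r s : ℕ}

theorem exists_natCast_rpow_eq_fkDet_rightMulMatrix
    (A : Matrix (Fin r) (Fin s) (MonoidAlgebra ℤ G)) :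
    ∃ k : ℕ, fkDet (rightMulMatrix A) = (k : ℝ) ^ (1 / (2 * (Nat.card G : ℝ))) := by
  classical
  have := Fintype.ofFinite G
  obtain ⟨k, hk⟩ := exists_natCast_eq_pseudoDet_sq _ _ (toMatrix_rightMulMatrix A)
  refine ⟨k, ?_⟩
  rw [fkDet_eq_pseudoDet_rpow (isEquivariant_rightMulMatrix A), ← hk, ← Real.rpow_natCast,
    ← Real.rpow_mul (pseudoDet_pos _).le]
  congr 1
  push_cast
  field_simp

theorem two_rpow_le_fkDet_rightMulMatrix {A : Matrix (Fin r) (Fin s) (MonoidAlgebra ℤ G)}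
    (hA : 1 < fkDet (rightMulMatrix A)) :
    (2 : ℝ) ^ (1 / (2 * (Nat.card G : ℝ))) ≤ fkDet (rightMulMatrix A) := by
  obtain ⟨k, hk⟩ := exists_natCast_rpow_eq_fkDet_rightMulMatrix A
  rw [hk] at hA ⊢
  exact two_rpow_le_natCast_rpow (by positivity) hA

theorem two_rpow_le_fkDet_rightMulMatrix_of_isWeakIso
    {A : Matrix (Fin r) (Fin r) (MonoidAlgebra ℤ G)}
    (hA : IsWeakIso (rightMulMatrix A)) (hA' : 1 < fkDet (rightMulMatrix A)) :
    (2 : ℝ) ^ (1 / (Nat.card G : ℝ)) ≤ fkDet (rightMulMatrix A) := by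
  classical
  have := Fintype.ofFinite G
  rw [fkDet_rightMulMatrix_of_isWeakIso hA] at hA' ⊢
  exact two_rpow_le_natCast_rpow (by positivity) hA'

end LowerBound

section IntegerMatrixRing

variable {G : Type*} [Group G] {r s : ℕ}

theorem intMatrix_add (A B : Matrix (Fin r) (Fin s) (MonoidAlgebra ℤ G)) :
    intMatrix (A + B) = intMatrix A + intMatrix B := by
  ext p q
  simp [intMatrix]

theorem intMatrix_one [DecidableEq G] :
    intMatrix (1 : Matrix (Fin r) (Fin r) (MonoidAlgebra ℤ G)) = 1 := by
  ext ⟨i, g⟩ ⟨j, h⟩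
  rcases eq_or_ne i j with rfl | hij
  · simp [intMatrix, Matrix.one_apply, MonoidAlgebra.one_def, Finsupp.single_apply,
      eq_comm (a := (1 : G)), inv_mul_eq_one, eq_comm (a := h)]
  · simp [intMatrix, Matrix.one_apply, hij, hij.symm]

theorem det_intMatrix_two [Fintype G] [DecidableEq G] :
    (intMatrix (2 : Matrix (Fin 1) (Fin 1) (MonoidAlgebra ℤ G))).det = 2 ^ Nat.card G := by
  rw [← one_add_one_eq_two (R := Matrix _ _ _), intMatrix_add, intMatrix_one,
    ← two_smul ℤ, Matrix.det_smul]
  simp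

theorem isWeakIso_rightMulMatrix_two [Finite G] :
    IsWeakIso (rightMulMatrix (2 : Matrix (Fin 1) (Fin 1) (MonoidAlgebra ℤ G))) := by
  classical
  have := Fintype.ofFinite G
  rw [isWeakIso_rightMulMatrix_iff, det_intMatrix_two]
  positivity

theorem fkDet_rightMulMatrix_two [Finite G] :
    fkDet (rightMulMatrix (2 : Matrix (Fin 1) (Fin 1) (MonoidAlgebra ℤ G))) = 2 := by
  classical
  have := Fintype.ofFinite G
  rw [fkDet_rightMulMatrix_of_isWeakIso isWeakIso_rightMulMatrix_two, det_intMatrix_two,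
    Int.natAbs_pow, Nat.cast_pow, one_div, Real.pow_rpow_inv_natCast _ Nat.card_pos.ne']
  · norm_num
  · positivity

end IntegerMatrixRing

section Lehmer

theorem lehmerOneW_le_fkDet {G : Type*} [Group G]
    {A : Matrix (Fin 1) (Fin 1) (MonoidAlgebra ℤ G)} (hA : IsWeakIso (rightMulMatrix A))
    (hA' : 1 < fkDet (rightMulMatrix A)) : lehmerOneW G ≤ fkDet (rightMulMatrix A) :=
  csInf_le ⟨1, fun _ hd => hd.1.le⟩ ⟨hA', A, hA, rfl⟩

variable (G : Type*) [Group G] [Finite G]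

theorem two_rpow_le_lehmer : (2 : ℝ) ^ (1 / (2 * (Nat.card G : ℝ))) ≤ lehmer G := by
  refine le_csInf ⟨2, one_lt_two, 1, 1, _, le_rfl, le_rfl, fkDet_rightMulMatrix_two⟩ ?_
  rintro _ ⟨hd, r, s, A, -, -, rfl⟩
  exact two_rpow_le_fkDet_rightMulMatrix hd

theorem two_rpow_le_lehmerW : (2 : ℝ) ^ (1 / (Nat.card G : ℝ)) ≤ lehmerW G := by
  refine le_csInf ⟨2, one_lt_two, 1, _, le_rfl, isWeakIso_rightMulMatrix_two,
    fkDet_rightMulMatrix_two⟩ ?_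
  rintro _ ⟨hd, r, A, -, hA, rfl⟩
  exact two_rpow_le_fkDet_rightMulMatrix_of_isWeakIso hA hd

theorem lehmer_le_lehmerOne : lehmer G ≤ lehmerOne G := by
  refine csInf_le_csInf ⟨1, fun d hd => hd.1.le⟩ ⟨2, one_lt_two, _, fkDet_rightMulMatrix_two⟩ ?_
  rintro d ⟨hd, A, hA⟩
  exact ⟨hd, 1, 1, A, le_rfl, le_rfl, hA⟩

theorem lehmerW_le_lehmerOneW : lehmerW G ≤ lehmerOneW G := by
  refine csInf_le_csInf ⟨1, fun d hd => hd.1.le⟩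
    ⟨2, one_lt_two, _, isWeakIso_rightMulMatrix_two, fkDet_rightMulMatrix_two⟩ ?_
  rintro d ⟨hd, A, hA⟩
  exact ⟨hd, 1, A, le_rfl, hA⟩

theorem lehmerOne_le_lehmerOneW : lehmerOne G ≤ lehmerOneW G := by
  refine csInf_le_csInf ⟨1, fun d hd => hd.1.le⟩
    ⟨2, one_lt_two, _, isWeakIso_rightMulMatrix_two, fkDet_rightMulMatrix_two⟩ ?_
  rintro d ⟨hd, A, -, hA⟩
  exact ⟨hd, A, hA⟩

end Lehmer

section Cyclic

theorem exists_notMem_apply_mem {ι : Type*} [Finite ι] {σ : Equiv.Perm ι}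
    (hσ : σ.IsCycleOn Set.univ) {s : Set ι} (hs : s.Nonempty) (hs' : s ≠ Set.univ) :
    ∃ i ∉ s, σ i ∈ s := by
  by_contra! hinv
  obtain ⟨a, ha⟩ := (Set.ne_univ_iff_exists_notMem s).1 hs'
  obtain ⟨b, hb⟩ := hs
  obtain ⟨k, rfl⟩ := (hσ.2 (mem_univ a) (mem_univ b)).exists_nat_pow_eq
  have horbit : ∀ k : ℕ, (σ ^ k) a ∉ s := fun k => by
    induction k with
    | zero => exact ha
    | succ k ih => exact pow_succ' σ k ▸ hinv _ ih
  exact horbit k hb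

theorem det_add_eq_sum_piecewise {R ι : Type*} [CommRing R] [Fintype ι] [DecidableEq ι]
    (A B : Matrix ι ι R) :
    (A + B).det = ∑ s : Finset ι, (Matrix.of (s.piecewise A.row B.row)).det :=
  Matrix.detRowAlternating.map_add_univ A.row B.row

-- Expand by rows, those in `s` taken from `1` and the others from the permutation matrix. If
-- `i ∉ s` and `σ i ∈ s`, the rows `i` and `σ i` agree, so only `s = univ` and `s = ∅` contribute.
theorem det_one_add_permMatrix {R ι : Type*} [CommRing R] [Fintype ι] [DecidableEq ι] [Nonempty ι]
    {σ : Equiv.Perm ι} (hσ : σ.IsCycleOn Set.univ) :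
    (1 + σ.permMatrix R).det = 1 + (Equiv.Perm.sign σ : ℤ) := by
  have hrow : ∀ i, (σ.permMatrix R).row i = (1 : Matrix ι ι R).row (σ i) := fun i => by
    ext j
    simp [PEquiv.toMatrix_apply, Matrix.one_apply, eq_comm]
  have hzero : ∀ s : Finset ι, s ≠ Finset.univ ∧ s ≠ ∅ →
      (Matrix.of (s.piecewise (1 : Matrix ι ι R).row (σ.permMatrix R).row)).det = 0 := by
    rintro s ⟨hs, hs'⟩
    obtain ⟨i, hi, hσi⟩ := exists_notMem_apply_mem hσ (s := s)
      (Finset.nonempty_iff_ne_empty.2 hs') (mt Finset.coe_eq_univ.1 hs)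
    rw [Finset.mem_coe] at hi hσi
    have hrows : s.piecewise (1 : Matrix ι ι R).row (σ.permMatrix R).row i =
        s.piecewise (1 : Matrix ι ι R).row (σ.permMatrix R).row (σ i) := by
      rw [Finset.piecewise_eq_of_notMem _ _ _ hi, Finset.piecewise_eq_of_mem _ _ _ hσi, hrow]
    exact Matrix.det_zero_of_row_eq (fun h : i = σ i => hi (h ▸ hσi)) hrows
  rw [det_add_eq_sum_piecewise, Fintype.sum_eq_add _ _ Finset.univ_nonempty.ne_empty hzero,
    Finset.piecewise_univ, Finset.piecewise_empty]
  exact congrArg₂ _ Matrix.det_one (Matrix.det_permutation σ)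

theorem sign_eq_one_of_pow_eq_one {ι : Type*} [Fintype ι] [DecidableEq ι] {σ : Equiv.Perm ι}
    {n : ℕ} (hn : Odd n) (hσ : σ ^ n = 1) : Equiv.Perm.sign σ = 1 := by
  rw [← pow_one (Equiv.Perm.sign σ), ← Nat.odd_iff.1 hn, ← Int.units_pow_eq_pow_mod_two,
    ← map_pow, hσ, map_one]

variable {G : Type*} [Group G]

theorem isCycleOn_univ_mulRight {t : G} (ht : Subgroup.zpowers t = ⊤) :
    (Equiv.mulRight t).IsCycleOn Set.univ := by
  refine ⟨(Equiv.mulRight t).bijective.bijOn_univ, fun a _ b _ => ?_⟩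
  obtain ⟨k, hk⟩ := Subgroup.mem_zpowers_iff.1 (ht ▸ Subgroup.mem_top (a⁻¹ * b))
  exact ⟨k, by simp [hk]⟩

theorem submatrix_intMatrix_of [DecidableEq G] (t : G) :
    (intMatrix (Matrix.of fun _ _ : Fin 1 => MonoidAlgebra.of ℤ G t)).submatrix
      (Equiv.uniqueProd G (Fin 1)).symm (Equiv.uniqueProd G (Fin 1)).symm =
      (Equiv.mulRight t⁻¹).permMatrix ℤ := by
  ext g h
  have hiff : t = h⁻¹ * g ↔ g * t⁻¹ = h := by
    rw [eq_inv_mul_iff_mul_eq, mul_inv_eq_iff_eq_mul, eq_comm]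
  simp [intMatrix, Finsupp.single_apply, PEquiv.toMatrix_apply, hiff]

theorem det_intMatrix_of_add_one [Fintype G] [DecidableEq G] (hG : Odd (Nat.card G)) {t : G}
    (ht : Subgroup.zpowers t = ⊤) :
    (intMatrix (Matrix.of fun _ _ : Fin 1 => MonoidAlgebra.of ℤ G t + 1)).det = 2 := by
  have hcycle : (Equiv.mulRight t⁻¹).IsCycleOn Set.univ :=
    isCycleOn_univ_mulRight (by rw [Subgroup.zpowers_inv, ht])
  have hsign : Equiv.Perm.sign (Equiv.mulRight t⁻¹) = 1 :=
    sign_eq_one_of_pow_eq_one hG (by simp [Equiv.pow_mulRight])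
  have hadd : (Matrix.of fun _ _ : Fin 1 => MonoidAlgebra.of ℤ G t + 1) =
      1 + Matrix.of fun _ _ => MonoidAlgebra.of ℤ G t := by
    ext1 i j
    simp [Subsingleton.elim i j, add_comm]
  rw [hadd, intMatrix_add, intMatrix_one,
    ← Matrix.det_submatrix_equiv_self (Equiv.uniqueProd G (Fin 1)).symm, Matrix.submatrix_add,
    Pi.add_apply, Pi.add_apply, Matrix.submatrix_one_equiv, submatrix_intMatrix_of,
    det_one_add_permMatrix hcycle, hsign]
  norm_num

variable [Finite G]

theorem isWeakIso_rightMulMatrix_of_add_one (hG : Odd (Nat.card G)) {t : G}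
    (ht : Subgroup.zpowers t = ⊤) :
    IsWeakIso (rightMulMatrix (Matrix.of fun _ _ : Fin 1 => MonoidAlgebra.of ℤ G t + 1)) := by
  classical
  have := Fintype.ofFinite G
  rw [isWeakIso_rightMulMatrix_iff, det_intMatrix_of_add_one hG ht]
  exact two_ne_zero

theorem fkDet_rightMulMatrix_of_add_one (hG : Odd (Nat.card G)) {t : G}
    (ht : Subgroup.zpowers t = ⊤) :
    fkDet (rightMulMatrix (Matrix.of fun _ _ : Fin 1 => MonoidAlgebra.of ℤ G t + 1)) =
      (2 : ℝ) ^ (1 / (Nat.card G : ℝ)) := by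
  classical
  have := Fintype.ofFinite G
  rw [fkDet_rightMulMatrix_of_isWeakIso (isWeakIso_rightMulMatrix_of_add_one hG ht),
    det_intMatrix_of_add_one hG ht]
  norm_num

theorem lehmerOneW_le_two_rpow [IsCyclic G] (hG : Odd (Nat.card G)) :
    lehmerOneW G ≤ (2 : ℝ) ^ (1 / (Nat.card G : ℝ)) := by
  obtain ⟨t, ht⟩ := IsCyclic.exists_generator (α := G)
  have ht' : Subgroup.zpowers t = ⊤ := (Subgroup.eq_top_iff' _).2 ht
  rw [← fkDet_rightMulMatrix_of_add_one hG ht']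
  refine lehmerOneW_le_fkDet (isWeakIso_rightMulMatrix_of_add_one hG ht') ?_
  rw [fkDet_rightMulMatrix_of_add_one hG ht']
  exact Real.one_lt_rpow one_lt_two (by have := hG.pos; positivity)

end Cyclic

theorem mainTheorem11_general {G : Type*} [Group G] [IsCyclic G] (hG : Odd (Nat.card G)) :
    lehmerW G = (2 : ℝ) ^ (1 / (Nat.card G : ℝ)) ∧
    lehmerOneW G = (2 : ℝ) ^ (1 / (Nat.card G : ℝ)) ∧
    (∀ t : G, Subgroup.zpowers t = ⊤ →
      IsWeakIso (rightMulMatrix (Matrix.of fun _ _ : Fin 1 => MonoidAlgebra.of ℤ _ t + 1)) ∧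
      fkDet (rightMulMatrix (Matrix.of fun _ _ : Fin 1 => MonoidAlgebra.of ℤ _ t + 1)) =
        (2 : ℝ) ^ (1 / (Nat.card G : ℝ))) ∧
    (2 : ℝ) ^ (1 / (2 * (Nat.card G : ℝ))) ≤ lehmer G ∧
    lehmer G ≤ lehmerOne G ∧
    lehmerOne G ≤ (2 : ℝ) ^ (1 / (Nat.card G : ℝ)) := by
  have : Finite G := Nat.finite_of_card_ne_zero hG.pos.ne'
  have hle : lehmerOneW G ≤ (2 : ℝ) ^ (1 / (Nat.card G : ℝ)) := lehmerOneW_le_two_rpow hG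
  have hge : (2 : ℝ) ^ (1 / (Nat.card G : ℝ)) ≤ lehmerW G := two_rpow_le_lehmerW G
  have hW : lehmerW G ≤ lehmerOneW G := lehmerW_le_lehmerOneW G
  exact ⟨(hW.trans hle).antisymm hge, hle.antisymm (hge.trans hW),
    fun t ht => ⟨isWeakIso_rightMulMatrix_of_add_one hG ht, fkDet_rightMulMatrix_of_add_one hG ht⟩,
    two_rpow_le_lehmer G, lehmer_le_lehmerOne G, (lehmerOne_le_lehmerOneW G).trans hle⟩

end LehmerGroup

end

theorem mainTheorem11 (n : ℕ) (hn : Odd n) :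
    LehmerGroup.lehmerW (Multiplicative (ZMod n)) = (2 : ℝ) ^ (1 / (n : ℝ)) ∧
    LehmerGroup.lehmerOneW (Multiplicative (ZMod n)) = (2 : ℝ) ^ (1 / (n : ℝ)) ∧
    (∀ t : Multiplicative (ZMod n), Subgroup.zpowers t = ⊤ →
      LehmerGroup.IsWeakIso (LehmerGroup.rightMulMatrix
        (Matrix.of fun _ _ : Fin 1 => MonoidAlgebra.of ℤ _ t + 1)) ∧
      LehmerGroup.fkDet (LehmerGroup.rightMulMatrix
        (Matrix.of fun _ _ : Fin 1 => MonoidAlgebra.of ℤ _ t + 1)) = (2 : ℝ) ^ (1 / (n : ℝ))) ∧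
    (2 : ℝ) ^ (1 / (2 * (n : ℝ))) ≤ LehmerGroup.lehmer (Multiplicative (ZMod n)) ∧
    LehmerGroup.lehmer (Multiplicative (ZMod n)) ≤
      LehmerGroup.lehmerOne (Multiplicative (ZMod n)) ∧
    LehmerGroup.lehmerOne (Multiplicative (ZMod n)) ≤ (2 : ℝ) ^ (1 / (n : ℝ)) := by
  have hcard : Nat.card (Multiplicative (ZMod n)) = n := Nat.card_zmod n
  simpa only [hcard] using
    LehmerGroup.mainTheorem11_general (G := Multiplicative (ZMod n)) (by rwa [hcard])
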